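/- Let $\mathcal V$ and $\mathcal W$ be varieties of algebras (possibly of different finitary functional signatures, nullary symbols allowed), each of which is the class of all nonempty models of some set of identities of height at most $1$, that is, of identities $s\approx t$ in which each of $s,t$ is a variable or a term $f(x_1,\dots,x_k)$ with $f$ a basic operation symbol of arity $k\ge 0$ and $x_1,\dots,x_k$ not necessarily distinct variables. Write $\mathcal X\le\mathcal Y$ if there is a clone homomorphism from the clone of $\mathcal X$ to the clone of $\mathcal Y$, i.e. a map from the term operations of $\mathcal X$ of positive arity to those of $\mathcal Y$ that preserves arities, projections and composition. Let $\mathcal V\vee\mathcal W$ denote the join of $\mathcal V$ and $\mathcal W$ in the lattice of interpretability types of varieties, that is, any variety that is a least upper bound of $\mathcal V$ and $\mathcal W$ for the quasi-order $\le$; for instance, the variety whose signature is the disjoint union of the signatures of $\mathcal V$ and $\mathcal W$ and whose defining identities are the union of their defining identities. 1. If neither $\mathcal V$ nor $\mathcal W$ is congruence modular, then $\mathcal V\vee\mathcal W$ is not congruence modular. (A variety is congruence modular if the congruence lattice of each of its members is modular.) 2. If, for every $n\ge 2$, neither $\mathcal V$ nor $\mathcal W$ is congruence $n$-permutable, then for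 every $n\ge 2$ the variety $\mathcal V\vee\mathcal W$ is not congruence $n$-permutable. (A variety is congruence $n$-permutable if $\theta\circ\psi\circ\theta\circ\cdots=\psi\circ\theta\circ\psi\circ\cdots$, with $n$ factors on each side, for all congruences $\theta,\psi$ of each of its members.) -/

import Mathlib

open FirstOrder FirstOrder.Language

universe u

/-- The height of a term: variables have height `0`, and `f(t₁, …, tₙ)` has height one more than the
largest height of the `tᵢ`. In particular a nullary symbol, like every `f(x₁, …, xₙ)` with variables
`xᵢ`, has height `1`. -/
def termHeight {L : FirstOrder.Language.{u, 0}} {α : Type} : L.Term α → ℕ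
  | .var _ => 0
  | .func _ ts => (Finset.univ.sup fun i => termHeight (ts i)) + 1

/-- The identity `s ≈ t` holds in the algebra `A`. -/
def SatisfiesIdentity (L : FirstOrder.Language.{u, 0}) (A : Type u) [L.Structure A] {α : Type}
    (s t : L.Term α) : Prop :=
  ∀ v : α → A, s.realize v = t.realize v

/-- A variety of algebras, presented by a purely functional signature and a set of identities in
countably many variables. The class of algebras itself is `Variety.Mem`. -/
structure Variety where
  /-- the signature -/
  L : FirstOrder.Language.{u, 0}
  /-- the signature has no relation symbols -/
  algebraic : L.IsAlgebraic
  /-- a set of identities that defines the variety -/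
  identities : Set (L.Term ℕ × L.Term ℕ)

namespace Variety

/-- The algebra `A` (with nonempty domain) is a model of the set `E` of identities. -/
def IsModel {L : FirstOrder.Language.{u, 0}} (E : Set (L.Term ℕ × L.Term ℕ)) (A : Type u) [L.Structure A] :
    Prop :=
  Nonempty A ∧ ∀ e ∈ E, SatisfiesIdentity L A e.1 e.2

/-- The algebra `A` belongs to the variety `V`. -/
def Mem (V : Variety.{u}) (A : Type u) [V.L.Structure A] : Prop :=
  IsModel V.identities A

/-- `V` is, as a class of algebras, the class of models of some set of identities `s ≈ t` in which
both `s` and `t` have height at most `1`. -/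
def DefinedByHeightAtMostOne (V : Variety.{u}) : Prop :=
  ∃ E : Set (V.L.Term ℕ × V.L.Term ℕ),
    (∀ e ∈ E, termHeight e.1 ≤ 1 ∧ termHeight e.2 ≤ 1) ∧
    ∀ (A : Type u) [V.L.Structure A], V.Mem A ↔ IsModel E A

end Variety

/-! ### Congruences -/

/-- A congruence of the `L`-algebra `A`: an equivalence relation preserved by all basic
operations. -/
@[ext]
structure Congruence (L : FirstOrder.Language.{u, 0}) (A : Type u) [L.Structure A] where
  /-- the underlying equivalence relation -/
  toSetoid : Setoid A
  compatible : ∀ {n : ℕ} (f : L.Functions n) (x y : Fin n → A),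
    (∀ i, toSetoid (x i) (y i)) → toSetoid (Structure.funMap f x) (Structure.funMap f y)

namespace Congruence

variable {L : FirstOrder.Language.{u, 0}} {A : Type u} [L.Structure A]

/-- Congruences are ordered by inclusion. -/
instance : PartialOrder (Congruence L A) :=
  PartialOrder.lift Congruence.toSetoid fun _ _ h => Congruence.ext h

/-- The infimum of a set of congruences is its intersection. -/
instance : InfSet (Congruence L A) where
  sInf S :=
    { toSetoid :=
        { r := fun a b => ∀ θ ∈ S, θ.toSetoid a b
          iseqv :=
            ⟨fun _ θ _ => θ.toSetoid.refl _, fun h θ hθ => θ.toSetoid.symm (h θ hθ),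
             fun h k θ hθ => θ.toSetoid.trans (h θ hθ) (k θ hθ)⟩ }
      compatible := fun f x y h θ hθ => θ.compatible f x y fun i => h i θ hθ }

/-- The congruence lattice of `A`; the supremum is the least congruence above. -/
instance : CompleteLattice (Congruence L A) :=
  completeLatticeOfInf _ fun _ =>
    ⟨fun θ hθ _ _ h => h θ hθ, fun _ hψ _ _ h _ hθ => hψ hθ h⟩

/-- The `n`-fold alternating relational product `θ ∘ ψ ∘ θ ∘ ⋯` with `n` factors. -/
def altComp : ℕ → Congruence L A → Congruence L A → A → A → Prop
  | 0, _, _ => Eq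
  | n + 1, θ, ψ => Relation.Comp (fun a b => θ.toSetoid a b) (altComp n ψ θ)

end Congruence

namespace Variety

/-- A variety is congruence modular if all its members have modular congruence lattices. -/
def CongruenceModular (V : Variety.{u}) : Prop :=
  ∀ (A : Type u) [V.L.Structure A], V.Mem A → IsModularLattice (Congruence V.L A)

/-- A variety is congruence `n`-permutable if `θ ∘ ψ ∘ θ ∘ ⋯ = ψ ∘ θ ∘ ψ ∘ ⋯` (`n` factors on both
sides) for all congruences `θ`, `ψ` of a member. This notion is meant for `n ≥ 2`. -/
def CongruencePermutable (V : Variety.{u}) (n : ℕ) : Prop :=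
  ∀ (A : Type u) [V.L.Structure A], V.Mem A →
    ∀ θ ψ : Congruence V.L A, Congruence.altComp n θ ψ = Congruence.altComp n ψ θ

/-! ### The clone of a variety and the interpretability quasi-order -/

/-- Two `n`-ary terms are equivalent if they induce the same operation on all members of `V`. -/
def termSetoid (V : Variety.{u}) (n : ℕ) : Setoid (V.L.Term (Fin n)) where
  r s t := ∀ (A : Type u) [V.L.Structure A], V.Mem A → SatisfiesIdentity V.L A s t
  iseqv :=
    ⟨fun _ _ _ _ _ => rfl, fun h A _ hA v => (h A hA v).symm,
     fun h k A _ hA v => (h A hA v).trans (k A hA v)⟩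

/-- The `n`-ary part of the clone of `V`: the `n`-ary term operations of `V`, that is, `n`-ary terms
modulo the identities valid in `V`. For every generator of `V` this is the same thing as the set of
its `n`-ary term operations, since a generator satisfies the same identities as `V`. -/
def Clo (V : Variety.{u}) (n : ℕ) : Type u := Quotient (V.termSetoid n)

namespace Clo

variable {V : Variety.{u}} {n m : ℕ}

/-- The term operation given by a term. -/
def mk (t : V.L.Term (Fin n)) : V.Clo n := Quotient.mk (V.termSetoid n) t

/-- The `i`-th `n`-ary projection. -/
def proj (i : Fin n) : V.Clo n := mk (.var i)

/-- Composition `f(g₁, …, gₙ)`. -/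
noncomputable def comp (f : V.Clo n) (g : Fin n → V.Clo m) : V.Clo m :=
  mk ((Quotient.out f).subst fun i => Quotient.out (g i))

/-- Composition does not depend on the terms that represent the operations. -/
theorem comp_mk (t : V.L.Term (Fin n)) (s : Fin n → V.L.Term (Fin m)) :
    comp (mk t) (fun i => mk (s i)) = mk (t.subst s) := by
  refine Quotient.sound fun A _ hA v => ?_
  rw [Term.realize_subst, Term.realize_subst]
  have h1 : ∀ w, (Quotient.out (mk t)).realize w = t.realize w :=
    Quotient.mk_out (s := V.termSetoid n) t A hA
  have h2 : ∀ i w, (Quotient.out (mk (s i))).realize w = (s i).realize w := fun i =>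
    Quotient.mk_out (s := V.termSetoid m) (s i) A hA
  simp only [h1, h2]

end Clo

/-- A clone homomorphism from the clone of `V` to the clone of `W`. As usual for function clones,
only operations of positive arity are considered (a constant is viewed as a constant unary
operation). -/
structure CloneHom (V W : Variety.{u}) where
  /-- the map on operations of arity `n + 1` -/
  toFun : ∀ n : ℕ, V.Clo (n + 1) → W.Clo (n + 1)
  map_proj : ∀ (n : ℕ) (i : Fin (n + 1)), toFun n (Clo.proj i) = Clo.proj i
  map_comp : ∀ (n m : ℕ) (f : V.Clo (n + 1)) (g : Fin (n + 1) → V.Clo (m + 1)),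
    toFun m (Clo.comp f g) = Clo.comp (toFun n f) fun i => toFun m (g i)

/-- The interpretability quasi-order on varieties. -/
def Interpretable (V W : Variety.{u}) : Prop := Nonempty (CloneHom V W)

/-- `U` represents the join of `V` and `W` in the lattice of interpretability types of varieties:
it is a least upper bound of `V` and `W` in the interpretability quasi-order. -/
def IsJoin (V W U : Variety.{u}) : Prop :=
  Interpretable V U ∧ Interpretable W U ∧
    ∀ X : Variety.{u}, Interpretable V X → Interpretable W X → Interpretable U X

/-- The standard representative of the join: the signature is the disjoint union of the signatures
and the defining identities are the union of the defining identities. -/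
def join (V W : Variety.{u}) : Variety.{u} where
  L := V.L.sum W.L
  algebraic := by
    have := V.algebraic
    have := W.algebraic
    infer_instance
  identities :=
    Prod.map LHom.sumInl.onTerm LHom.sumInl.onTerm '' V.identities ∪
      Prod.map LHom.sumInr.onTerm LHom.sumInr.onTerm '' W.identities

/-! ### The join exists -/

namespace Clo
variable {V : Variety.{u}} {n m : ℕ}

/-- The operation that an element of the clone of `V` induces on a member `A` of `V`. -/
noncomputable def eval (f : V.Clo n) {A : Type u} [V.L.Structure A] (v : Fin n → A) : A :=
  (Quotient.out f).realize v

theorem eval_mk {A : Type u} [V.L.Structure A] (hA : V.Mem A) (t : V.L.Term (Fin n))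
    (v : Fin n → A) : (mk t).eval v = t.realize v :=
  Quotient.mk_out (s := V.termSetoid n) t A hA v

theorem eval_proj {A : Type u} [V.L.Structure A] (hA : V.Mem A) (i : Fin n) (v : Fin n → A) :
    (proj i : V.Clo n).eval v = v i :=
  eval_mk hA _ v

theorem eval_comp {A : Type u} [V.L.Structure A] (hA : V.Mem A) (f : V.Clo n)
    (g : Fin n → V.Clo m) (v : Fin m → A) :
    (comp f g).eval v = f.eval fun i => (g i).eval v := by
  rw [comp, eval_mk hA, Term.realize_subst]; rfl

theorem ext_eval {f g : V.Clo n}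
    (h : ∀ (A : Type u) [V.L.Structure A], V.Mem A → ∀ v : Fin n → A, f.eval v = g.eval v) :
    f = g := by
  rw [← Quotient.out_eq f, ← Quotient.out_eq g]
  exact Quotient.sound fun A _ hA v => h A hA v

end Clo

/-- A term only depends on finitely many variables. -/
theorem realize_relabel_min {L : FirstOrder.Language.{u, 0}} {A : Type u} [L.Structure A]
    (v : ℕ → A) (t : L.Term ℕ) : ∃ N, ∀ m, N ≤ m →
    (t.relabel fun k => (⟨min k m, by omega⟩ : Fin (m + 1))).realize (fun i : Fin (m + 1) => v i) =
      t.realize v := by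
  induction t with
  | var k => exact ⟨k, fun m h => by simp [h]⟩
  | func f ts ih =>
    choose N hN using ih
    refine ⟨Finset.univ.sup N, fun m h => ?_⟩
    simp only [Term.relabel, Term.realize_func]
    congr 1
    funext i
    exact hN i m ((Finset.le_sup (Finset.mem_univ i)).trans h)

/-- The operation symbol `f` with an additional dummy variable. -/
def dummy {L : FirstOrder.Language.{u, 0}} {n : ℕ} (f : L.Functions n) : L.Term (Fin (n + 1)) :=
  .func f fun i => .var i.castSucc

section
variable {V X : Variety.{u}}

theorem realize_dummy {n : ℕ} (f : V.L.Functions n) {A : Type u} [V.L.Structure A]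
    (x : Fin n → A) (a : A) :
    (dummy f).realize (Fin.snoc x a : Fin (n + 1) → A) = Structure.funMap f x := by
  simp [dummy]

theorem eval_snoc_eq (ξ : CloneHom V X) {n : ℕ} (f : V.L.Functions n) {B : Type u}
    [X.L.Structure B] (hB : X.Mem B) (x : Fin n → B) (b c : B) :
    (ξ.toFun n (Clo.mk (dummy f))).eval (Fin.snoc x b : Fin (n + 1) → B) =
    (ξ.toFun n (Clo.mk (dummy f))).eval (Fin.snoc x c : Fin (n + 1) → B) := by
  let p : Fin (n + 1) → V.Clo (n + 2) :=
    Fin.snoc (fun i => Clo.proj i.castSucc.castSucc) (Clo.proj (Fin.last n).castSucc)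
  let q : Fin (n + 1) → V.Clo (n + 2) :=
    Fin.snoc (fun i => Clo.proj i.castSucc.castSucc) (Clo.proj (Fin.last (n + 1)))
  have hpq : Clo.comp (Clo.mk (dummy f)) p = Clo.comp (Clo.mk (dummy f)) q := by
    refine Clo.ext_eval fun A _ hA v => ?_
    rw [Clo.eval_comp hA, Clo.eval_comp hA, Clo.eval_mk hA, Clo.eval_mk hA]
    simp [dummy, p, q]
  have h := congrArg (fun F => (ξ.toFun (n + 1) F).eval
    (Fin.snoc (Fin.snoc x b : Fin (n + 1) → B) c : Fin (n + 2) → B)) hpq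
  simp only [ξ.map_comp, Clo.eval_comp hB] at h
  convert h using 2 <;> funext i <;> refine Fin.lastCases ?_ (fun j => ?_) i <;>
    simp [p, q, ξ.map_proj, Clo.eval_proj hB]

/-- A clone homomorphism from `V` to `X` turns members of `X` into algebras in the signature of
`V`. -/
@[reducible]
noncomputable def pullback (ξ : CloneHom V X) (B : Type u) [X.L.Structure B] (b : B) :
    V.L.Structure B where
  funMap {n} f x := (ξ.toFun n (Clo.mk (dummy f))).eval (Fin.snoc x b : Fin (n + 1) → B)
  RelMap {n} r := ((V.algebraic n).false r).elim

theorem comp_dummy {n m : ℕ} (f : V.L.Functions n) (ts : Fin n → V.L.Term (Fin (m + 1))) :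
    Clo.comp (Clo.mk (dummy f))
      (Fin.snoc (fun i => Clo.mk (ts i)) (Clo.proj 0) : Fin (n + 1) → V.Clo (m + 1)) =
    Clo.mk (.func f ts) := by
  refine Clo.ext_eval fun A _ hA v => ?_
  rw [Clo.eval_comp hA, Clo.eval_mk hA, Clo.eval_mk hA]
  simp [dummy, Clo.eval_mk hA]

theorem realize_pullback (ξ : CloneHom V X) {B : Type u} [X.L.Structure B] (hB : X.Mem B) (b : B)
    {m : ℕ} (t : V.L.Term (Fin (m + 1))) (v : Fin (m + 1) → B) :
    letI := pullback ξ B b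
    t.realize v = (ξ.toFun m (Clo.mk t)).eval v := by
  let := pullback ξ B b
  induction t with
  | var i =>
    change v i = (ξ.toFun m (Clo.proj i)).eval v
    rw [ξ.map_proj, Clo.eval_proj hB]
  | func f ts ih =>
    rw [← comp_dummy, ξ.map_comp, Clo.eval_comp hB, Term.realize_func]
    change (ξ.toFun _ (Clo.mk (dummy f))).eval (Fin.snoc _ b : Fin _ → B) = _
    rw [eval_snoc_eq ξ f hB _ b (v 0)]
    congr 1
    funext i
    refine Fin.lastCases ?_ (fun j => ?_) i
    · simp [ξ.map_proj, Clo.eval_proj hB]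
    · simpa using ih j

theorem mem_pullback (ξ : CloneHom V X) {B : Type u} [X.L.Structure B] (hB : X.Mem B) (b : B) :
    letI := pullback ξ B b
    V.Mem B := by
  let := pullback ξ B b
  refine ⟨⟨b⟩, fun e he v => ?_⟩
  obtain ⟨N, hN⟩ := realize_relabel_min v e.1
  obtain ⟨M, hM⟩ := realize_relabel_min v e.2
  rw [← hN (max N M) (le_max_left _ _), ← hM (max N M) (le_max_right _ _),
    realize_pullback ξ hB b, realize_pullback ξ hB b]
  congr 2
  refine Quotient.sound fun A _ hA w => ?_
  rw [Term.realize_relabel, Term.realize_relabel]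
  exact hA.2 e he _

end

variable {V W X : Variety.{u}}


/-- An inclusion of presentations induces a clone homomorphism. -/
theorem interpretable_of_lhom (φ : V.L →ᴸ X.L)
    (hφ : ∀ e ∈ V.identities, (φ.onTerm e.1, φ.onTerm e.2) ∈ X.identities) :
    Interpretable V X := by
  have key : ∀ (A : Type u) [X.L.Structure A], X.Mem A →
      @Variety.Mem V A (φ.reduct A) := by
    intro A iA hA
    let := φ.reduct A
    refine ⟨hA.1, fun e he v => ?_⟩
    have := hA.2 _ (hφ e he) v
    simpa [LHom.realize_onTerm] using this
  have hmk : ∀ {n : ℕ} (s t : V.L.Term (Fin n)), (V.termSetoid n) s t →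
      (X.termSetoid n) (φ.onTerm s) (φ.onTerm t) := by
    intro n s t h A _ hA v
    let := φ.reduct A
    rw [LHom.realize_onTerm, LHom.realize_onTerm]
    exact h A (key A hA) v
  refine ⟨⟨fun n => Quotient.map φ.onTerm fun s t h => hmk s t h, fun n i => rfl,
    fun n m f g => ?_⟩⟩
  obtain ⟨t, rfl⟩ := Quotient.exists_rep f
  obtain ⟨s, rfl⟩ : ∃ s : Fin (n + 1) → V.L.Term (Fin (m + 1)), g = fun i => Clo.mk (s i) :=
    ⟨fun i => Quotient.out (g i), funext fun i => (Quotient.out_eq (g i)).symm⟩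
  change Quotient.map _ _ (Clo.comp (Clo.mk t) _) = Clo.comp (Clo.mk (φ.onTerm t))
    (fun i => Clo.mk (φ.onTerm (s i)))
  rw [Clo.comp_mk, Clo.comp_mk]
  refine Quotient.sound fun A _ hA v => ?_
  let := φ.reduct A
  simp only [LHom.realize_onTerm, Term.realize_subst]

/-- The map on terms of the join that is determined by clone homomorphisms from `V` and `W`. -/
noncomputable def joinMap (ξ : CloneHom V X) (η : CloneHom W X) {m : ℕ} :
    (V.L.sum W.L).Term (Fin (m + 1)) → X.Clo (m + 1)
  | .var i => Clo.proj i
  | .func (l := n) (.inl f) ts => Clo.comp (ξ.toFun n (Clo.mk (dummy f)))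
      (Fin.snoc (fun i => joinMap ξ η (ts i)) (Clo.proj 0) : Fin (n + 1) → X.Clo (m + 1))
  | .func (l := n) (.inr f) ts => Clo.comp (η.toFun n (Clo.mk (dummy f)))
      (Fin.snoc (fun i => joinMap ξ η (ts i)) (Clo.proj 0) : Fin (n + 1) → X.Clo (m + 1))

theorem eval_joinMap (ξ : CloneHom V X) (η : CloneHom W X) {B : Type u} [X.L.Structure B]
    (hB : X.Mem B) (b : B) {m : ℕ} (t : (V.L.sum W.L).Term (Fin (m + 1))) (v : Fin (m + 1) → B) :
    letI := pullback ξ B b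
    letI := pullback η B b
    (joinMap ξ η t).eval v = t.realize v := by
  let := pullback ξ B b
  let := pullback η B b
  induction t with
  | var i => exact Clo.eval_proj hB _ _
  | func f ts ih =>
    rcases f with f | f
    · refine (Clo.eval_comp hB _ _ _).trans ?_
      change _ = (ξ.toFun _ (Clo.mk (dummy f))).eval (Fin.snoc _ b : Fin _ → B)
      rw [eval_snoc_eq ξ f hB _ b (v 0)]
      congr 1
      funext i
      refine Fin.lastCases ?_ (fun j => ?_) i
      · simp [Clo.eval_proj hB]
      · simpa using ih j
    · refine (Clo.eval_comp hB _ _ _).trans ?_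
      change _ = (η.toFun _ (Clo.mk (dummy f))).eval (Fin.snoc _ b : Fin _ → B)
      rw [eval_snoc_eq η f hB _ b (v 0)]
      congr 1
      funext i
      refine Fin.lastCases ?_ (fun j => ?_) i
      · simp [Clo.eval_proj hB]
      · simpa using ih j

theorem mem_join (A : Type u) [V.L.Structure A] [W.L.Structure A] (h : V.Mem A) (k : W.Mem A) :
    letI : (join V W).L.Structure A := inferInstanceAs ((V.L.sum W.L).Structure A)
    (join V W).Mem A := by
  let : (join V W).L.Structure A := inferInstanceAs ((V.L.sum W.L).Structure A)
  refine ⟨h.1, ?_⟩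
  rintro _ (⟨e, he, rfl⟩ | ⟨e, he, rfl⟩) v
  · exact (LHom.realize_onTerm (LHom.sumInl : V.L →ᴸ V.L.sum W.L) e.1 v).trans
      ((h.2 e he v).trans (LHom.realize_onTerm (LHom.sumInl : V.L →ᴸ V.L.sum W.L) e.2 v).symm)
  · exact (LHom.realize_onTerm (LHom.sumInr : W.L →ᴸ V.L.sum W.L) e.1 v).trans
      ((k.2 e he v).trans (LHom.realize_onTerm (LHom.sumInr : W.L →ᴸ V.L.sum W.L) e.2 v).symm)

/-- Clone homomorphisms from `V` and `W` to `X` extend to the join. -/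
noncomputable def joinHom (ξ : CloneHom V X) (η : CloneHom W X) : CloneHom (join V W) X where
  toFun n := Quotient.lift (s := (join V W).termSetoid (n + 1)) (joinMap ξ η) (by
    intro s t h
    refine Clo.ext_eval fun B _ hB v => ?_
    refine (eval_joinMap ξ η hB (v 0) s v).trans
      (Eq.trans ?_ (eval_joinMap ξ η hB (v 0) t v).symm)
    let := pullback ξ B (v 0)
    let := pullback η B (v 0)
    let : (join V W).L.Structure B := inferInstanceAs ((V.L.sum W.L).Structure B)
    exact h B (mem_join B (mem_pullback ξ hB _) (mem_pullback η hB _)) v)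
  map_proj n i := rfl
  map_comp n m f g := by
    obtain ⟨t, rfl⟩ := Quotient.exists_rep f
    obtain ⟨s, rfl⟩ : ∃ s : Fin (n + 1) → (join V W).L.Term (Fin (m + 1)),
        g = fun i => Clo.mk (s i) :=
      ⟨fun i => Quotient.out (g i), funext fun i => (Quotient.out_eq (g i)).symm⟩
    change Quotient.lift _ _ (Clo.comp (Clo.mk t) _) = Clo.comp (joinMap ξ η t)
      (fun i => joinMap ξ η (s i))
    rw [Clo.comp_mk]
    change joinMap ξ η (t.subst s) = _
    refine Clo.ext_eval fun B _ hB v => ?_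
    refine (eval_joinMap ξ η hB (v 0) _ v).trans (Eq.trans ?_ (Eq.trans
      (eval_joinMap ξ η hB (v 0) t _).symm (Clo.eval_comp hB _ _ _).symm))
    let := pullback ξ B (v 0)
    let := pullback η B (v 0)
    refine (Term.realize_subst (L := V.L.sum W.L)).trans ?_
    congr 1
    funext i
    exact (eval_joinMap ξ η hB (v 0) _ _).symm

/-- The standard representative is indeed a join; in particular, joins exist. -/
theorem isJoin_join : IsJoin V W (join V W) :=
  ⟨interpretable_of_lhom (X := join V W) LHom.sumInl fun e he => Or.inl ⟨e, he, rfl⟩,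
    interpretable_of_lhom (X := join V W) LHom.sumInr fun e he => Or.inr ⟨e, he, rfl⟩,
    fun _ ⟨ξ⟩ ⟨η⟩ => ⟨joinHom ξ η⟩⟩

end Variety

/-! Both claims reduce to finding, in `V` and in `W`, members on one and the same finite set whose
operations preserve one and the same fixed relations. Such members combine into a member of `join V
W`, hence of `U`, that still preserves these relations, and the relations alone refute the
congruence condition.

Identities of height at most one make such members easy to build. Take a product `F` of members,
generators `gen : C → F` and any colouring `col : F → C` with `col ∘ gen = id`; then `C` with
operations `col (f (gen x₁, …, gen xₙ))` is again a member (`mem_reflection`). It remains to choose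
the colouring.

Modularity: `C` is the square with a pentagon of equivalences. A non-modular congruence lattice
contains a failure of a shifting principle (`exists_shifting_failure`), and the colour of `p`
records how `p` acts on valuations built from the failing points.

Permutability: `C` is the two-element chain. Colouring exactly the elements reachable from `gen
true` by increasing arguments makes all operations monotone. If `gen false` were reachable, a
Hagemann–Mitschke chain would make some chosen algebra permutable (`altComp_of_reachedIn`). -/

namespace Variety

/-! ### Reflections, products and the passage to the join -/

section Reflection

/-- The binary relation `R` is preserved by all basic operations. -/
def Preserved (L : FirstOrder.Language.{u, 0}) {A : Type u} [L.Structure A] (R : A → A → Prop) :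
    Prop :=
  ∀ (n : ℕ) (f : L.Functions n) (x y : Fin n → A),
    (∀ i, R (x i) (y i)) → R (Structure.funMap f x) (Structure.funMap f y)

/-- A compatible equivalence relation as a congruence. -/
def Preserved.congruence {L : FirstOrder.Language.{u, 0}} {A : Type u} [L.Structure A]
    {R : A → A → Prop} (h : Preserved L R) (hR : Equivalence R) : Congruence L A where
  toSetoid := ⟨R, hR⟩
  compatible f x y hxy := h _ f x y hxy

theorem Preserved.realize {L : FirstOrder.Language.{u, 0}} {A : Type u} [L.Structure A]
    {R : A → A → Prop} (h : Preserved L R) {α : Type} (t : L.Term α) {v w : α → A}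
    (hvw : ∀ i, R (v i) (w i)) : R (t.realize v) (t.realize w) := by
  induction t with
  | var i => exact hvw i
  | func f ts ih => exact h _ f _ _ ih

/-- The reflection of an algebra along a pair of maps. -/
@[reducible]
def reflection (L : FirstOrder.Language.{u, 0}) {F C : Type u} [L.Structure F] (g : C → F)
    (c : F → C) : L.Structure C where
  funMap f x := c (Structure.funMap f fun i => g (x i))
  RelMap r x := Structure.RelMap r fun i => g (x i)

/-- At most one operation symbol occurs, so `g ∘ c` is never inserted between nested operations; for
a variable the claim is `hc` itself. This is where the height bound enters. -/
theorem realize_reflection {L : FirstOrder.Language.{u, 0}} {F C : Type u} [L.Structure F]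
    (g : C → F) (c : F → C) (hc : ∀ x, c (g x) = x) {α : Type} (t : L.Term α)
    (ht : termHeight t ≤ 1) (v : α → C) :
    letI := reflection L g c
    t.realize v = c (t.realize fun i => g (v i)) := by
  let := reflection L g c
  cases t with
  | var i => exact (hc _).symm
  | func f ts =>
    have h0 : ∀ i, termHeight (ts i) = 0 := fun i => by
      have h1 := Finset.le_sup (f := fun i => termHeight (ts i)) (Finset.mem_univ i)
      simp only [termHeight] at ht h1
      omega
    change c (Structure.funMap f _) = c (Structure.funMap f _)
    congr 2
    funext i
    have := h0 i
    cases h : ts i with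
    | var j => simp [h]
    | func f' ts' => rw [h] at this; simp [termHeight] at this

/-- Reflections preserve identities of height at most one if generators keep their colour. -/
theorem mem_reflection {V : Variety.{u}} (hV : V.DefinedByHeightAtMostOne) {F C : Type u}
    [V.L.Structure F] (hF : V.Mem F) (g : C → F) (c : F → C) (hc : ∀ x, c (g x) = x) :
    letI := reflection V.L g c
    V.Mem C := by
  let := reflection V.L g c
  obtain ⟨E, hE, hVE⟩ := hV
  rw [hVE] at hF ⊢
  refine ⟨hF.1.map c, fun e he v => ?_⟩
  rw [realize_reflection g c hc _ (hE e he).1, realize_reflection g c hc _ (hE e he).2,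
    hF.2 e he]

/-- The product of a family of algebras. -/
@[reducible]
def piStructure (L : FirstOrder.Language.{u, 0}) {I : Type u} (A : I → Type u)
    [∀ i, L.Structure (A i)] : L.Structure (∀ i, A i) where
  funMap f x i := Structure.funMap f fun j => x j i
  RelMap r x := ∀ i, Structure.RelMap r fun j => x j i

theorem mem_pi {V : Variety.{u}} {I : Type u} (A : I → Type u) [∀ i, V.L.Structure (A i)]
    (hA : ∀ i, V.Mem (A i)) :
    letI := piStructure V.L A
    V.Mem (∀ i, A i) := by
  let := piStructure V.L A
  have hr : ∀ (t : V.L.Term ℕ) (v : ℕ → ∀ i, A i) (i : I),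
      t.realize v i = t.realize fun k => v k i := by
    intro t v i
    induction t with
    | var k => rfl
    | func f ts ih =>
      change Structure.funMap f (fun j => (ts j).realize v i) = _
      simp only [ih, Term.realize_func]
  refine ⟨⟨fun i => (hA i).1.some⟩, fun e he v => funext fun i => ?_⟩
  rw [hr, hr]
  exact (hA i).2 e he _

/-- A common member of `V` and `W` can be turned into a member of any join of `V` and `W`, whose
operations preserve the same reflexive relations. -/
theorem exists_structure_of_isJoin {V W U : Variety.{u}} (hU : IsJoin V W U) {C : Type u}
    [V.L.Structure C] [W.L.Structure C] (hV : V.Mem C) (hW : W.Mem C) :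
    ∃ _ : U.L.Structure C, U.Mem C ∧ ∀ R : C → C → Prop, (∀ x, R x x) →
      Preserved V.L R → Preserved W.L R → Preserved U.L R := by
  let : (join V W).L.Structure C := inferInstanceAs ((V.L.sum W.L).Structure C)
  obtain ⟨ξ⟩ := hU.2.2 (join V W) isJoin_join.1 isJoin_join.2.1
  obtain ⟨b⟩ := hV.1
  refine ⟨pullback ξ C b, mem_pullback ξ (mem_join C hV hW) b, fun R hR hRV hRW => ?_⟩
  have hRJ : Preserved (join V W).L R := by
    rintro n (f | f) x y hxy
    · exact hRV n f x y hxy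
    · exact hRW n f x y hxy
  intro n f x y hxy
  refine hRJ.realize _ fun i => ?_
  refine Fin.lastCases ?_ (fun j => ?_) i
  -- The dummy argument is the fixed point `b` on both sides; this is why `R` must be reflexive.
  · simpa using hR b
  · simpa using hxy j

end Reflection

/-! ### Congruence modularity -/

section Modularity

variable {L : FirstOrder.Language.{u, 0}} {A : Type u} [L.Structure A]

/-- The relations `β`, `β ∘ γ ∘ β`, `(β ∘ γ ∘ β) ∘ γ ∘ (β ∘ γ ∘ β)`, and so on. -/
def iterComp (β γ : Congruence L A) : ℕ → A → A → Prop
  | 0, x, y => β.toSetoid x y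
  | k + 1, x, y => ∃ a b, iterComp β γ k x a ∧ γ.toSetoid a b ∧ iterComp β γ k b y

theorem iterComp_refl (β γ : Congruence L A) (k : ℕ) (x : A) : iterComp β γ k x x := by
  induction k with
  | zero => exact β.toSetoid.refl x
  | succ k ih => exact ⟨x, x, ih, γ.toSetoid.refl x, ih⟩

theorem iterComp_symm (β γ : Congruence L A) (k : ℕ) {x y : A} (h : iterComp β γ k x y) :
    iterComp β γ k y x := by
  induction k generalizing x y with
  | zero => exact β.toSetoid.symm h
  | succ k ih =>
    obtain ⟨a, b, h1, h2, h3⟩ := h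
    exact ⟨b, a, ih h3, γ.toSetoid.symm h2, ih h1⟩

theorem iterComp_mono (β γ : Congruence L A) {x y : A} :
    Monotone fun k => iterComp β γ k x y :=
  monotone_nat_of_le_succ fun k h =>
    ⟨y, y, h, γ.toSetoid.refl y, iterComp_refl β γ k y⟩

theorem preserved_iterComp (β γ : Congruence L A) (k : ℕ) :
    Preserved L (iterComp β γ k) := by
  induction k with
  | zero => exact fun n f x y h => β.compatible f x y h
  | succ k ih =>
    intro n f x y h
    choose a b h1 h2 h3 using h
    exact ⟨_, _, ih n f x a h1, γ.compatible f a b h2, ih n f b y h3⟩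

/-- The union of the increasing chain `iterComp β γ k` is a congruence above both: operations are
finitary, so finitely many stages have a common bound. -/
theorem exists_iterComp_of_sup (β γ : Congruence L A) {x y : A}
    (h : (γ ⊔ β).toSetoid x y) : ∃ k, iterComp β γ k x y := by
  have hp : Preserved L fun x y => ∃ k, iterComp β γ k x y := by
    intro n f x y h
    choose k hk using h
    exact ⟨_, preserved_iterComp β γ (Finset.univ.sup k) n f x y fun i =>
      iterComp_mono β γ (Finset.le_sup (Finset.mem_univ i)) (hk i)⟩
  let δ : Congruence L A := hp.congruence
    ⟨fun x => ⟨0, iterComp_refl β γ 0 x⟩, fun ⟨k, h⟩ => ⟨k, iterComp_symm β γ k h⟩,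
      fun {x y z} ⟨k, h⟩ ⟨l, h'⟩ => ⟨max k l + 1, y, y,
        iterComp_mono β γ (le_max_left k l) h, γ.toSetoid.refl y,
        iterComp_mono β γ (le_max_right k l) h'⟩⟩
  have hγ : γ ≤ δ := fun x y h => ⟨1, x, y, β.toSetoid.refl x, h, β.toSetoid.refl y⟩
  have hβ : β ≤ δ := fun x y h => ⟨0, h⟩
  exact sup_le hγ hβ h

/-- A failure of modularity yields a failure of the shifting principle for a compatible
reflexive symmetric relation. -/
theorem exists_shifting_failure (h : ¬ IsModularLattice (Congruence L A)) :
    ∃ (α γ : Congruence L A) (R : A → A → Prop) (a b c d : A),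
      (∀ x, R x x) ∧ Preserved L R ∧ γ ≤ α ∧
      (∀ x y, α.toSetoid x y → R x y → γ.toSetoid x y) ∧
      γ.toSetoid a b ∧ R a c ∧ R b d ∧ α.toSetoid c d ∧ ¬ γ.toSetoid c d := by
  by_contra hcon
  refine h ⟨fun {γ} β α hγα => ?_⟩
  -- If shifting never failed, induction on `k` would give `α ∩ iterComp β δ k ⊆ δ`, and the union
  -- over `k` is the modular law. A first failure at `k + 1` is a path from `c` through `a`, `b` to
  -- `d`, with `R` the stage `k`.
  set δ := γ ⊔ β ⊓ α with hδ
  have hδα : δ ≤ α := sup_le hγα inf_le_right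
  have hk : ∀ k x y, α.toSetoid x y → iterComp β δ k x y → δ.toSetoid x y := by
    intro k
    induction k with
    | zero =>
      intro x y hα hβ
      refine (le_sup_right : β ⊓ α ≤ δ) ?_
      rintro θ (rfl | rfl)
      · exact hβ
      · exact hα
    | succ k ih =>
      rintro c d hα ⟨a, b, h1, h2, h3⟩
      by_contra hcd
      exact hcon ⟨α, δ, iterComp β δ k, a, b, c, d, iterComp_refl β δ k,
        preserved_iterComp β δ k, hδα, ih, h2, iterComp_symm β δ k h1, h3, hα, hcd⟩
  intro x y hxy
  have h1 : (γ ⊔ β).toSetoid x y := (inf_le_left : (γ ⊔ β) ⊓ α ≤ _) hxy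
  have h2 : α.toSetoid x y := (inf_le_right : (γ ⊔ β) ⊓ α ≤ _) hxy
  obtain ⟨k, hk'⟩ := exists_iterComp_of_sup β δ
    (sup_le_sup_right (le_sup_left : γ ≤ δ) β h1)
  exact hk k x y h2 hk'

/-- The four-element set that carries the non-modular configuration of equivalences `eqFst`,
`eqSnd`, `eqLower`. -/
abbrev Square : Type u := ULift.{u} (Bool × Bool)

/-- Equality of first coordinates. -/
def eqFst (x y : Square.{u}) : Prop := x.down.1 = y.down.1

/-- Equality of second coordinates. -/
def eqSnd (x y : Square.{u}) : Prop := x.down.2 = y.down.2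

/-- The equivalence whose only nontrivial class consists of the pairs with first coordinate
`false`. -/
def eqLower (x y : Square.{u}) : Prop :=
  x.down.1 = y.down.1 ∧ (x.down.1 = true → x.down.2 = y.down.2)

/-- The three equivalences generate a pentagon: `γ < α`, `β ⊓ α` is equality, and `γ ⊔ β` joins
`(true, false)` to `(true, true)` through the lower row. -/
theorem not_congruenceModular_of_square {V : Variety.{u}} [V.L.Structure Square.{u}]
    (hV : V.Mem Square.{u}) (h1 : Preserved V.L eqFst.{u}) (h2 : Preserved V.L eqSnd.{u})
    (h3 : Preserved V.L eqLower.{u}) : ¬ V.CongruenceModular := by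
  intro hmod
  have := hmod Square hV
  let α := h1.congruence ⟨fun _ => rfl, fun h => Eq.symm h, fun h k => Eq.trans h k⟩
  let β := h2.congruence ⟨fun _ => rfl, fun h => Eq.symm h, fun h k => Eq.trans h k⟩
  let γ := h3.congruence ⟨fun _ => ⟨rfl, fun _ => rfl⟩,
    fun h => ⟨h.1.symm, fun k => (h.2 (h.1.trans k)).symm⟩,
    fun h k => ⟨h.1.trans k.1, fun l => (h.2 l).trans (k.2 (h.1.symm.trans l))⟩⟩
  have hγα : γ ≤ α := fun _ _ h => h.1
  have hle : γ ⊔ β ⊓ α ≤ γ := sup_le le_rfl fun x y h =>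
    ⟨h α (Or.inr rfl), fun _ => h β (Or.inl rfl)⟩
  have hβ : β ≤ γ ⊔ β := le_sup_right
  have hγ : γ ≤ γ ⊔ β := le_sup_left
  have hcd : ((γ ⊔ β) ⊓ α).toSetoid ⟨(true, false)⟩ ⟨(true, true)⟩ := by
    rintro θ (rfl | rfl)
    · refine (γ ⊔ β).toSetoid.trans (hβ (x := ⟨(true, false)⟩) (y := ⟨(false, false)⟩) rfl)
        ((γ ⊔ β).toSetoid.trans (b := ⟨(false, true)⟩) (hγ ⟨rfl, ?_⟩) (hβ rfl))
      intro h
      cases h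
    · rfl
  have := hle (IsModularLattice.sup_inf_le_assoc_of_le β hγα hcd)
  cases this.2 rfl

open Classical in
/-- A variety defined by identities of height at most one that is not congruence modular has a
member on the square whose operations preserve the non-modular configuration. -/
theorem exists_square_of_not_congruenceModular {V : Variety.{u}}
    (hV : V.DefinedByHeightAtMostOne) (hmod : ¬ V.CongruenceModular) :
    ∃ _ : V.L.Structure Square.{u}, V.Mem Square.{u} ∧ Preserved V.L eqFst.{u} ∧
      Preserved V.L eqSnd.{u} ∧ Preserved V.L eqLower.{u} := by
  simp only [CongruenceModular, not_forall] at hmod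
  obtain ⟨A, _, hA, hmod⟩ := hmod
  obtain ⟨α, γ, R, a, b, c, d, hRr, hR, hγα, hαR, hab, hac, hbd, hcd, hncd⟩ :=
    exists_shifting_failure hmod
  have hne : c ≠ d := fun h => hncd (h ▸ γ.toSetoid.refl c)
  let F : Type u := (Square.{u} → A) → A
  let : V.L.Structure F := piStructure V.L fun _ => A
  let fstConst (x y : A) : Square.{u} → A := fun s => if s.down.1 then y else x
  let sndConst : Square.{u} → A := fun s => if s.down.2 then d else c
  let gen : Square.{u} → F := fun s w => w s
  -- The first colour asks whether `p` becomes the second projection when variables with equal first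
  -- coordinate are identified. Generators keep their colours because `c ≠ d` and `c`, `d` are not
  -- `γ`-related.
  let col : F → Square.{u} := fun p =>
    ⟨decide (∀ x y, p (fstConst x y) = y), decide (γ.toSetoid (p sndConst) d)⟩
  have hcol : ∀ s, col (gen s) = s := by
    rintro ⟨s, t⟩
    simp only [col, gen, fstConst, sndConst]
    congr 2
    · cases s
      · simpa using ⟨c, d, hne⟩
      · simp
    · cases t
      · simpa using hncd
      · simp
  have hfst : ∀ (n : ℕ) (f : V.L.Functions n) (x y : Fin n → Square.{u}),
      (∀ i, eqFst (x i) (y i)) → ∀ u v,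
      (Structure.funMap f fun i => gen (x i)) (fstConst u v) =
        (Structure.funMap f fun i => gen (y i)) (fstConst u v) := by
    intro n f x y h u v
    change Structure.funMap f (fun i => fstConst u v (x i)) =
      Structure.funMap f (fun i => fstConst u v (y i))
    congr 1
    funext i
    simp only [fstConst]
    rw [show (x i).down.1 = (y i).down.1 from h i]
  refine ⟨reflection V.L gen col, mem_reflection hV (mem_pi _ fun _ => hA) gen col hcol,
    ?_, ?_, ?_⟩
  · intro n f x y h
    change decide _ = decide _
    simp only [hfst n f x y h]
  · intro n f x y h
    change decide (γ.toSetoid (Structure.funMap f fun i => sndConst (x i)) d) =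
      decide (γ.toSetoid (Structure.funMap f fun i => sndConst (y i)) d)
    have : (fun i => sndConst (x i)) = fun i => sndConst (y i) := by
      funext i
      simp only [sndConst]
      rw [show (x i).down.2 = (y i).down.2 from h i]
    rw [this]
  · intro n f x y h
    have hxy := hfst n f x y fun i => (h i).1
    refine ⟨?_, fun ht => ?_⟩
    · change decide _ = decide _
      simp only [hxy]
    have hx : ∀ u v, Structure.funMap f (fun i => fstConst u v (x i)) = v := of_decide_eq_true ht
    have hy : ∀ u v, Structure.funMap f (fun i => fstConst u v (y i)) = v := fun u v =>
      (hxy u v).symm.trans (hx u v)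
    -- This valuation places the failing configuration on the square. It turns `eqLower` into `γ`
    -- and is pointwise `R`-related to `sndConst`.
    let corners : Square.{u} → A := fun s =>
      if s.down.1 then (if s.down.2 then d else c) else (if s.down.2 then b else a)
    have key : ∀ z : Fin n → Square.{u},
        (∀ u v, Structure.funMap f (fun i => fstConst u v (z i)) = v) →
        γ.toSetoid (Structure.funMap f fun i => corners (z i))
          (Structure.funMap f fun i => sndConst (z i)) := by
      intro z hz
      -- Modulo `α`, `corners` is `fstConst a c` and `sndConst` is `fstConst c c`; by `hz` both
      -- values are then `α`-related to `c`, so `α ∩ R ⊆ γ` applies.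
      refine hαR _ _ ?_ (hR n f _ _ fun i => ?_)
      · have e1 : α.toSetoid (Structure.funMap f fun i => corners (z i)) c := by
          rw [← hz a c]
          refine α.compatible f _ _ fun i => ?_
          rcases z i with ⟨_ | _, _ | _⟩ <;> simp only [corners, fstConst] <;>
            first
            | exact α.toSetoid.refl _
            | exact α.toSetoid.symm (hγα hab)
            | exact α.toSetoid.symm hcd
        have e2 : α.toSetoid (Structure.funMap f fun i => sndConst (z i)) c := by
          rw [← hz c c]
          refine α.compatible f _ _ fun i => ?_
          rcases z i with ⟨_ | _, _ | _⟩ <;> simp only [sndConst, fstConst] <;>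
            first
            | exact α.toSetoid.refl _
            | exact α.toSetoid.symm hcd
        exact α.toSetoid.trans e1 (α.toSetoid.symm e2)
      · rcases z i with ⟨_ | _, _ | _⟩ <;> simp only [corners, sndConst] <;>
          first
          | exact hRr _
          | exact hac
          | exact hbd
    have hcor : γ.toSetoid (Structure.funMap f fun i => corners (x i))
        (Structure.funMap f fun i => corners (y i)) := by
      refine γ.compatible f _ _ fun i => ?_
      have := h i
      revert this
      rcases x i with ⟨_ | _, _ | _⟩ <;> rcases y i with ⟨_ | _, _ | _⟩ <;>
        simp [eqLower, corners] <;>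
        first
        | exact γ.toSetoid.refl _
        | exact hab
        | exact γ.toSetoid.symm hab
    have hsnd := γ.toSetoid.trans (γ.toSetoid.symm (key x hx)) (γ.toSetoid.trans hcor (key y hy))
    change decide (γ.toSetoid (Structure.funMap f fun i => sndConst (x i)) d) =
      decide (γ.toSetoid (Structure.funMap f fun i => sndConst (y i)) d)
    rw [decide_eq_decide]
    exact ⟨fun k => γ.toSetoid.trans (γ.toSetoid.symm hsnd) k, fun k => γ.toSetoid.trans hsnd k⟩

end Modularity

/-! ### Congruence `n`-permutability -/

section Permutability

/-- The order of the two-element chain. -/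
def boolLE (x y : ULift.{u} Bool) : Prop := x.down ≤ y.down

theorem altComp_succ {L : FirstOrder.Language.{u, 0}} {A : Type u} [L.Structure A] (n : ℕ)
    (θ ψ : Congruence L A) {a b : A} (h : Congruence.altComp n θ ψ a b) :
    Congruence.altComp (n + 1) θ ψ a b := by
  induction n generalizing θ ψ a with
  | zero => exact ⟨b, h ▸ θ.toSetoid.refl a, rfl⟩
  | succ n ih =>
    obtain ⟨c, h1, h2⟩ := h
    exact ⟨c, h1, ih ψ θ h2⟩

/-- Along an alternating product of a congruence that fixes the `j`-th coordinates and a congruence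
that fixes the coordinates of the other parity, the first zero moves by at most one per factor. -/
theorem eq_false_of_altComp {L : FirstOrder.Language.{u, 0}} {A : Type u} [L.Structure A]
    (s : A → ℕ → Bool) (hs : ∀ x, Antitone (s x)) (n j : ℕ) (θ ψ : Congruence L A)
    (hθ : ∀ x y k, θ.toSetoid x y → s x (j + 2 * k) = s y (j + 2 * k))
    (hψ : ∀ x y k, ψ.toSetoid x y → s x (j + 1 + 2 * k) = s y (j + 1 + 2 * k))
    {x y : A} (hx : s x j = false) (h : Congruence.altComp (n + 1) θ ψ x y) :
    s y (j + n) = false := by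
  induction n generalizing j θ ψ x with
  | zero =>
    obtain ⟨z, h1, rfl⟩ := h
    exact (hθ _ _ 0 h1).symm.trans hx
  | succ n ih =>
    obtain ⟨z, h1, h2⟩ := h
    have hz : s z j = false := (hθ _ _ 0 h1).symm.trans hx
    have hz' : s z (j + 1) = false := by
      have := hs z (Nat.le_succ j)
      rw [hz] at this
      exact le_bot_iff.1 this
    have := ih (j + 1) ψ θ hψ (fun x y k h => by
      have := hθ x y (k + 1) h
      rwa [show j + 2 * (k + 1) = j + 1 + 1 + 2 * k by ring] at this) hz' h2
    rwa [show j + 1 + n = j + (n + 1) by ring] at this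

/-- A variety with a member that is a two-element algebra with monotone operations is not
congruence `n`-permutable. -/
theorem not_congruencePermutable_of_monotone {V : Variety.{u}} [V.L.Structure (ULift.{u} Bool)]
    (hV : V.Mem (ULift.{u} Bool)) (hmon : Preserved V.L boolLE.{u}) (n : ℕ) (hn : 1 ≤ n) :
    ¬ V.CongruencePermutable n := by
  intro hperm
  -- Monotonicity of the operations makes the antitone sequences a subalgebra of the countable
  -- power; one algebra serves every `n`.
  let A : Type u := { s : ℕ → ULift.{u} Bool // Antitone fun k => (s k).down }
  let : V.L.Structure A :=
    { funMap := fun f x => ⟨fun k => Structure.funMap f fun i => (x i).1 k,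
        fun k l hkl => hmon _ f _ _ fun i => (x i).2 hkl⟩
      RelMap := fun r _ => ((V.algebraic _).false r).elim }
  have hr : ∀ (t : V.L.Term ℕ) (v : ℕ → A) (k : ℕ),
      (t.realize v).1 k = t.realize fun i => (v i).1 k := by
    intro t v k
    induction t with
    | var i => rfl
    | func f ts ih =>
      change Structure.funMap f (fun j => ((ts j).realize v).1 k) = _
      simp only [ih, Term.realize_func]
  have hA : V.Mem A := by
    refine ⟨⟨⟨fun _ => ⟨false⟩, fun _ _ _ => le_rfl⟩⟩,
      fun e he v => Subtype.ext (funext fun k => ?_)⟩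
    rw [hr, hr]
    exact hV.2 e he _
  let θ (j : ℕ) : Congruence V.L A :=
    { toSetoid :=
        { r := fun x y => ∀ k, x.1 (j + 2 * k) = y.1 (j + 2 * k)
          iseqv := ⟨fun _ _ => rfl, fun h k => (h k).symm, fun h h' k => (h k).trans (h' k)⟩ }
      compatible := fun f x y h k => by
        change Structure.funMap f _ = Structure.funMap f _
        congr 1
        funext i
        exact h i k }
  let e (m : ℕ) : A := ⟨fun k => ⟨decide (k < m)⟩, fun k l hkl => by
    change decide (l < m) ≤ decide (k < m)
    by_cases h : l < m
    · simp [h, hkl.trans_lt h]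
    · simp [h]⟩
  have hpath : ∀ (m j : ℕ) (φ χ : Congruence V.L A),
      (∀ i, φ.toSetoid (e (j + 2 * i)) (e (j + 2 * i + 1))) →
      (∀ i, χ.toSetoid (e (j + 1 + 2 * i)) (e (j + 1 + 2 * i + 1))) →
      Congruence.altComp m φ χ (e j) (e (j + m)) := by
    intro m
    induction m with
    | zero => exact fun j φ χ _ _ => rfl
    | succ m ih =>
      intro j φ χ hφ hχ
      refine ⟨e (j + 1), hφ 0, ?_⟩
      have := ih (j + 1) χ φ hχ fun i => by
        have := hφ (i + 1)
        rwa [show j + 2 * (i + 1) = j + 1 + 1 + 2 * i by ring] at this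
      rwa [show j + 1 + m = j + (m + 1) by ring] at this
  -- `e i` and `e (i + 1)` differ only at position `i`, so `θ 1` and `θ 0` alternate along the path.
  -- In the opposite order the first factor fixes position `0` and is wasted: position `n - 1` stays
  -- `false`, but it is `true` in `e n`.
  have hup : Congruence.altComp n (θ 1) (θ 0) (e 0) (e n) := by
    have := hpath n 0 (θ 1) (θ 0)
      (fun i k => by simp only [e]; congr 2; simp only [eq_iff_iff]; omega)
      (fun i k => by simp only [e]; congr 2; simp only [eq_iff_iff]; omega)
    simpa using this
  rw [hperm A hA] at hup
  obtain ⟨m, rfl⟩ : ∃ m, n = m + 1 := ⟨n - 1, by omega⟩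
  have := eq_false_of_altComp (fun x k => (x.1 k).down) (fun x => x.2) m 0 (θ 0) (θ 1)
    (fun x y k h => congrArg ULift.down (h k)) (fun x y k h => congrArg ULift.down (h k))
    (by simp [e]) hup
  simp [e] at this

/-- The elements of `F` that are reached from the generator `gen true` in `k` steps, each of
which increases the arguments of a basic operation. -/
def ReachedIn (L : FirstOrder.Language.{u, 0}) {F : Type u} [L.Structure F]
    (gen : ULift.{u} Bool → F) : ℕ → F → Prop
  | 0, p => p = gen ⟨true⟩
  | k + 1, p => ∃ (n : ℕ) (f : L.Functions n) (x y : Fin n → ULift.{u} Bool),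
      (∀ i, boolLE (x i) (y i)) ∧ p = (Structure.funMap f fun i => gen (y i)) ∧
      ReachedIn L gen k (Structure.funMap f fun i => gen (x i))

/-- The Hagemann–Mitschke argument, for a homomorphism-like evaluation `ev` of `F` in `A`. -/
theorem altComp_of_reachedIn {L : FirstOrder.Language.{u, 0}} {F A : Type u} [L.Structure F]
    [L.Structure A] (gen : ULift.{u} Bool → F) (ev : (ULift.{u} Bool → A) → F → A)
    (hgen : ∀ w s, ev w (gen s) = w s)
    (hev : ∀ w {n : ℕ} (f : L.Functions n) (x : Fin n → ULift.{u} Bool),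
      ev w (Structure.funMap f fun i => gen (x i)) = Structure.funMap f fun i => w (x i))
    {k m : ℕ} (hkm : k ≤ m) {p : F} (hp : ReachedIn L gen k p) (θ ψ : Congruence L A)
    {a₀ a₁ e : A} (h₀ : θ.toSetoid a₀ a₁) (h₁ : Congruence.altComp m ψ θ a₁ e) :
    Congruence.altComp (m + 1) ψ θ (ev (fun s => bif s.down then a₁ else a₀) p) e := by
  induction k generalizing m p θ ψ a₀ a₁ with
  | zero =>
    rw [show p = gen ⟨true⟩ from hp, hgen]
    exact altComp_succ m ψ θ h₁
  | succ k ih =>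
    obtain ⟨m, rfl⟩ : ∃ l, m = l + 1 := ⟨m - 1, by omega⟩
    obtain ⟨n, f, x, y, hxy, rfl, hp⟩ := hp
    obtain ⟨a₂, h₁, h₂⟩ := h₁
    obtain ⟨c, hc, hce⟩ := ih (by omega) hp ψ θ h₁ h₂
    -- Since `x i ≤ y i`, there are three cases. Replacing `a₁` by `a₂` where `x i` is true is a
    -- `ψ`-step; replacing `a₀` by `a₁` elsewhere is a `θ`-step, absorbed into the first factor
    -- supplied by induction.
    refine ⟨Structure.funMap f fun i =>
      bif (x i).down then a₂ else bif (y i).down then a₁ else a₀, ?_, c, ?_, hce⟩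
    · rw [hev]
      refine ψ.compatible f _ _ fun i => ?_
      have := hxy i
      revert this
      rcases x i with ⟨_ | _⟩ <;> rcases y i with ⟨_ | _⟩ <;> simp [boolLE]
      exact h₁
    · refine θ.toSetoid.trans ?_ hc
      rw [hev]
      refine θ.compatible f _ _ fun i => ?_
      have := hxy i
      revert this
      rcases x i with ⟨_ | _⟩ <;> rcases y i with ⟨_ | _⟩ <;> simp [boolLE]
      exact h₀

open Classical in
/-- A variety defined by identities of height at most one that is not congruence `n`-permutable for
any `n` has a two-element member with monotone operations. -/
theorem exists_monotone_of_not_congruencePermutable {V : Variety.{u}}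
    (hV : V.DefinedByHeightAtMostOne) (hperm : ∀ n, 2 ≤ n → ¬ V.CongruencePermutable n) :
    ∃ _ : V.L.Structure (ULift.{u} Bool), V.Mem (ULift.{u} Bool) ∧ Preserved V.L boolLE.{u} := by
  have hperm' : ∀ k : ℕ, ∃ (A : Type u) (_ : V.L.Structure A), V.Mem A ∧
      ∃ θ ψ : Congruence V.L A, Congruence.altComp (k + 2) θ ψ ≠ Congruence.altComp (k + 2) ψ θ := by
    intro k
    have := hperm (k + 2) (by omega)
    simp only [CongruencePermutable, not_forall] at this
    obtain ⟨A, i, hA, θ, ψ, h⟩ := this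
    exact ⟨A, i, hA, θ, ψ, h⟩
  choose A hAs hA θ ψ hne using hperm'
  -- One product over all `k` and all valuations is needed, since the length of a chain reaching
  -- `gen false` is not known in advance.
  let I : Type u := Σ k : ULift.{u} ℕ, (ULift.{u} Bool → A k.down)
  let F : Type u := ∀ i : I, A i.1.down
  let : V.L.Structure F := piStructure V.L fun i : I => A i.1.down
  let gen : ULift.{u} Bool → F := fun s i => i.2 s
  let col : F → ULift.{u} Bool := fun p => ⟨decide (∃ k, ReachedIn V.L gen k p)⟩
  have hcol : ∀ s, col (gen s) = s := by
    rintro ⟨_ | _⟩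
    · refine congrArg ULift.up (decide_eq_false ?_)
      rintro ⟨k, hk⟩
      -- A chain of length `k` to `gen false` would make `A k` satisfy `k + 2`-permutability,
      -- against its choice.
      have key : ∀ φ χ : Congruence V.L (A k), ∀ x y,
          Congruence.altComp (k + 2) φ χ x y → Congruence.altComp (k + 2) χ φ x y := by
        rintro φ χ x y ⟨z, h1, h2⟩
        exact altComp_of_reachedIn gen (fun w p => p ⟨⟨k⟩, w⟩) (fun _ _ => rfl)
          (fun _ _ _ _ => rfl) (Nat.le_succ k) hk φ χ h1 h2
      exact hne k (funext fun x => funext fun y => propext ⟨key _ _ x y, key _ _ x y⟩)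
    · exact congrArg ULift.up (decide_eq_true ⟨0, rfl⟩)
  refine ⟨reflection V.L gen col, mem_reflection hV (mem_pi _ fun i => hA i.1.down) gen col hcol,
    fun n f x y hxy => ?_⟩
  change decide _ ≤ decide _
  rw [Bool.le_iff_imp, decide_eq_true_iff, decide_eq_true_iff]
  rintro ⟨k, hk⟩
  -- Monotonicity is built into the colouring: increasing the arguments is one further step of the
  -- chain.
  exact ⟨k + 1, n, f, x, y, hxy, rfl, hk⟩

end Permutability

end Variety

/-! ### Assembly of the two statements -/

theorem theorem1p8 (V W : Variety.{u})
    (hV : V.DefinedByHeightAtMostOne) (hW : W.DefinedByHeightAtMostOne)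
    (U : Variety.{u}) (hU : Variety.IsJoin V W U) :
    (¬ V.CongruenceModular → ¬ W.CongruenceModular → ¬ U.CongruenceModular) ∧
    ((∀ n, 2 ≤ n → ¬ V.CongruencePermutable n) → (∀ n, 2 ≤ n → ¬ W.CongruencePermutable n) →
      ∀ n, 2 ≤ n → ¬ U.CongruencePermutable n) := by
  constructor
  · intro h k
    obtain ⟨_, hV, hV1, hV2, hV3⟩ := Variety.exists_square_of_not_congruenceModular hV h
    obtain ⟨_, hW, hW1, hW2, hW3⟩ := Variety.exists_square_of_not_congruenceModular hW k
    obtain ⟨_, hUm, hR⟩ := Variety.exists_structure_of_isJoin hU hV hW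
    exact Variety.not_congruenceModular_of_square hUm
      (hR _ (fun _ => rfl) hV1 hW1) (hR _ (fun _ => rfl) hV2 hW2)
      (hR _ (fun _ => ⟨rfl, fun _ => rfl⟩) hV3 hW3)
  · intro h k n hn
    obtain ⟨_, hV, hV1⟩ := Variety.exists_monotone_of_not_congruencePermutable hV h
    obtain ⟨_, hW, hW1⟩ := Variety.exists_monotone_of_not_congruencePermutable hW k
    obtain ⟨_, hUm, hR⟩ := Variety.exists_structure_of_isJoin hU hV hW
    exact Variety.not_congruencePermutable_of_monotone hUm
      (hR _ (fun _ => le_rfl) hV1 hW1) n (by omega)
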